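/- Let $\mathbb{P}$ be a poset. A \emph{band} of $\mathbb{P}$ is a finite $B\subseteq\mathbb{P}$ such that every $p\in\mathbb{P}$ is comparable to some $b\in B$; a \emph{cap} is a set $C\subseteq\mathbb{P}$ for which there is a band $B$ such that every $b\in B$ lies below some $c\in C$; a \emph{selector} is a set $S\subseteq\mathbb{P}$ that meets every cap. The \emph{spectrum} $\mathsf{S}\mathbb{P}$ is the set of all minimal selectors (with respect to inclusion), with the topology that has the sets $p^\in=\{S\in\mathsf{S}\mathbb{P}:p\in S\}$, $p\in\mathbb{P}$, as a subbasis. Write $p\wedge q$ if $p$ and $q$ have a common lower bound in $\mathbb{P}$, and $p\vartriangleleft q$ if there is a cap $C$ such that every $c\in C$ with $c\wedge p$ satisfies $c\leq q$. Call $\mathbb{P}$ an \emph{$\omega$-poset} if every principal filter $\{q:q\geq p\}$ is finite and, for each $n\in\mathbb{N}$, only finitely many principal filters have exactly $n$ elements; \emph{regular} if for every cap $C$ there is a cap $D$ such that every $d\in D$ satisfies $d\vartriangleleft c$ for some $c\in C$; and \emph{prime} if $p^\in\neq\emptyset$ for every $p\in\mathbb{P}$. For posets $\mathbb{P}$ and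 $\mathbb{Q}$, a relation ${\sqsupset}\subseteq\mathbb{Q}\times\mathbb{P}$ is a \emph{refiner} if for every cap $D$ of $\mathbb{Q}$ there is a cap $C$ of $\mathbb{P}$ such that for every $c\in C$ there is $d\in D$ with $d\sqsupset c$; it is \emph{$\wedge$-preserving} if $q\sqsupset p$, $p\wedge p'$ and $q'\sqsupset p'$ imply $q\wedge q'$. Let $\mathbf{P}$ be the category whose objects are the regular prime $\omega$-posets and whose morphisms from $\mathbb{P}$ to $\mathbb{Q}$ are the $\wedge$-preserving refiners ${\sqsupset}\subseteq\mathbb{Q}\times\mathbb{P}$, with composition of relations as composition and equality relations as identities. Let $\mathbf{K}$ be the category of metrisable compact spaces and continuous maps. \textbf{Theorem.} For every object $\mathbb{P}$ of $\mathbf{P}$ the spectrum $\mathsf{S}\mathbb{P}$ is a metrisable compact space, and for every morphism ${\sqsupset}\subseteq\mathbb{Q}\times\mathbb{P}$ from $\mathbb{P}$ to $\mathbb{Q}$ in $\mathbf{P}$, \[\phi_\sqsupset(S)=S^{\sqsubset\vartriangleleft}=\{q\in\mathbb{Q}:\exists p\in S\ \exists q'\in\mathbb{Q}\ (q'\sqsupset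 p\text{ and }q'\vartriangleleft q)\}\] defines a continuous map $\phi_\sqsupset:\mathsf{S}\mathbb{P}\to\mathsf{S}\mathbb{Q}$. The assignments $\mathbb{P}\mapsto\mathsf{S}\mathbb{P}$ and ${\sqsupset}\mapsto\phi_\sqsupset$ define a functor $\mathsf{S}:\mathbf{P}\to\mathbf{K}$, and this functor is full and essentially surjective. -/

import Mathlib

open CategoryTheory

universe u

namespace PosetSpectrum

/-- `S^⊏ = {b | ∃ s ∈ S, s ⊏ b}` for a relation `⊏` between `A` and `B`. -/
def upImage {A B : Type u} (r : A → B → Prop) (S : Set A) : Set B :=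
  {b | ∃ s ∈ S, r s b}

/-- `S` refines `T` with respect to a relation `⊏`: every `s ∈ S` satisfies `s ⊏ t` for some
`t ∈ T`. -/
def Refines {A B : Type u} (r : A → B → Prop) (S : Set A) (T : Set B) : Prop :=
  ∀ s ∈ S, ∃ t ∈ T, r s t

section Poset

variable {P : Type u} [PartialOrder P]

/-- A band is a finite set such that every element of the poset is comparable to one of its
members. -/
def IsBand (B : Set P) : Prop :=
  B.Finite ∧ ∀ p : P, ∃ b ∈ B, b ≤ p ∨ p ≤ b

/-- A cap is a set refined by some band. -/
def IsCap (C : Set P) : Prop :=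
  ∃ B : Set P, IsBand B ∧ Refines (· ≤ ·) B C

/-- A selector is a set overlapping every cap. -/
def IsSelector (S : Set P) : Prop :=
  ∀ C : Set P, IsCap C → (S ∩ C).Nonempty

/-- `p ∧ q`: the elements `p` and `q` have a common lower bound. -/
def Wedge (p q : P) : Prop :=
  ∃ r : P, r ≤ p ∧ r ≤ q

/-- The star `Cp` of `p` in `C`. -/
def star (C : Set P) (p : P) : Set P :=
  {c ∈ C | Wedge p c}

/-- The star-below relation `p ◁ q`: for some cap `C`, every member of the star `Cp` is below
`q`. -/
def StarBelow (p q : P) : Prop :=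
  ∃ C : Set P, IsCap C ∧ ∀ c ∈ star C p, c ≤ q

variable (P)

/-- An `ω`-poset: principal filters are finite and, for every `n`, only finitely many of them have
size `n` (principal filters correspond bijectively to elements). -/
def IsOmegaPoset : Prop :=
  (∀ p : P, (Set.Ici p).Finite) ∧ ∀ n : ℕ, {p : P | (Set.Ici p).ncard = n}.Finite

/-- A regular poset: every cap is `◁`-refined by a cap. -/
def IsRegularPoset : Prop :=
  ∀ C : Set P, IsCap C → ∃ D : Set P, IsCap D ∧ Refines StarBelow D C

/-- The spectrum of a poset: the set of its minimal selectors. -/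
def Spectrum : Type u :=
  {S : Set P // Minimal IsSelector S}

/-- The topology of the spectrum has the sets `p^∈ = {S | p ∈ S}` as a subbasis. -/
instance : TopologicalSpace (Spectrum P) :=
  TopologicalSpace.generateFrom (Set.range fun p : P => {S : Spectrum P | p ∈ S.1})

/-- A prime poset: `p^∈` is non-empty for every `p`. -/
def IsPrimePoset : Prop :=
  ∀ p : P, ∃ S : Spectrum P, p ∈ S.1

end Poset

section Relation

variable {P Q : Type u} [PartialOrder P] [PartialOrder Q]

/-- A relation `⊐ ⊆ Q × P` is a refiner if every cap of `Q` is refined, with respect to the inverse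
relation `⊏`, by a cap of `P`. -/
def IsRefiner (r : Q → P → Prop) : Prop :=
  ∀ D : Set Q, IsCap D → ∃ C : Set P, IsCap C ∧ Refines (flip r) C D

/-- A relation `⊐ ⊆ Q × P` is `∧`-preserving if `q ⊐ p`, `p ∧ p'` and `q' ⊐ p'` imply
`q ∧ q'`. -/
def WedgePreserving (r : Q → P → Prop) : Prop :=
  ∀ (p p' : P) (q q' : Q), r q p → Wedge p p' → r q' p' → Wedge q q'

/-- The set `S^{⊏◁}`. -/
def starImage (r : Q → P → Prop) (S : Set P) : Set Q :=
  upImage StarBelow (upImage (flip r) S)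

end Relation

/-- The objects of the category `𝐏`: regular prime `ω`-posets. -/
structure PCat : Type (u + 1) where
  carrier : Type u
  [order : PartialOrder carrier]
  omega : IsOmegaPoset carrier
  regular : IsRegularPoset carrier
  prime : IsPrimePoset carrier

namespace PCat

instance : CoeSort PCat.{u} (Type u) := ⟨PCat.carrier⟩

instance (P : PCat.{u}) : PartialOrder P := P.order

/-- The morphisms from `P` to `Q` in `𝐏`: `∧`-preserving refiners `⊐ ⊆ Q × P`. -/
@[ext]
structure Hom (P Q : PCat.{u}) : Type u where
  rel : Q → P → Prop
  refiner : IsRefiner rel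
  wedge : WedgePreserving rel

/-- Identities are the equality relations; composition is composition of relations. -/
instance : Category PCat.{u} where
  Hom := Hom
  id P :=
    { rel := fun q p => q = p
      refiner := fun D hD => ⟨D, hD, fun d hd => ⟨d, hd, rfl⟩⟩
      wedge := by
        rintro p p' _ _ rfl h rfl
        exact h }
  comp {P Q R} f g :=
    { rel := fun r p => ∃ q : Q, g.rel r q ∧ f.rel q p
      refiner := fun E hE => by
        obtain ⟨D, hD, hDE⟩ := g.refiner E hE
        obtain ⟨C, hC, hCD⟩ := f.refiner D hD
        refine ⟨C, hC, fun c hc => ?_⟩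
        obtain ⟨d, hd, hcd⟩ := hCD c hc
        obtain ⟨e, he, hde⟩ := hDE d hd
        exact ⟨e, he, d, hde, hcd⟩
      wedge := by
        rintro p p' r r' ⟨q, hrq, hqp⟩ h ⟨q', hrq', hqp'⟩
        exact g.wedge q q' r r' hrq (f.wedge p p' q q' hqp h hqp') hrq' }
  id_comp f := by
    apply Hom.ext
    funext q p
    simp
  comp_id f := by
    apply Hom.ext
    funext q p
    simp
  assoc f g h := by
    apply Hom.ext
    funext s p
    apply propext
    constructor
    · rintro ⟨r, hr, q, hq, hp⟩
      exact ⟨q, ⟨r, hr, hq⟩, hp⟩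
    · rintro ⟨q, ⟨r, hr, hq⟩, hp⟩
      exact ⟨r, hr, q, hq, hp⟩

end PCat

/-- The category `𝐊` of metrisable compact spaces and continuous maps (the Hausdorff condition
built into `CompHausLike` follows from metrisability). -/
abbrev KCat : Type (u + 1) :=
  CompHausLike.{u} (fun X => TopologicalSpace.MetrizableSpace X)

/-- The spectrum of a poset as an object of `𝐊`, once it is known to be compact and metrisable. -/
def spectrumObj (P : PCat.{u})
    (h : CompactSpace (Spectrum P) ∧ TopologicalSpace.MetrizableSpace (Spectrum P)) : KCat.{u} :=
  haveI := h.1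
  haveI := h.2
  { toTop := TopCat.of (Spectrum P)
    is_compact := h.1
    is_hausdorff := inferInstanceAs (T2Space (Spectrum P))
    prop := h.2 }

/-- The map `φ_⊐ : S ↦ S^{⊏◁}` between spectra, once its values are known to be minimal
selectors. -/
def spectrumMap {P Q : PCat.{u}} (f : P ⟶ Q)
    (h : ∀ S : Spectrum P, Minimal IsSelector (starImage f.rel S.1)) :
    Spectrum P → Spectrum Q :=
  fun S => ⟨starImage f.rel S.1, h S⟩

/-- The functor `𝖲 : 𝐏 ⥤ 𝐊` with `P ↦ 𝖲P` and `⊐ ↦ φ_⊐`, assembled from the facts that say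
that these assignments do define a functor to `𝐊`. -/
def spectrumFunctor
    (hobj : ∀ P : PCat.{u},
      CompactSpace (Spectrum P) ∧ TopologicalSpace.MetrizableSpace (Spectrum P))
    (hsel : ∀ (P Q : PCat.{u}) (f : P ⟶ Q) (S : Spectrum P),
      Minimal IsSelector (starImage f.rel S.1))
    (hcont : ∀ (P Q : PCat.{u}) (f : P ⟶ Q), Continuous (spectrumMap f (hsel P Q f)))
    (hid : ∀ (P : PCat.{u}) (S : Spectrum P), spectrumMap (𝟙 P) (hsel P P (𝟙 P)) S = S)
    (hcomp : ∀ (P Q R : PCat.{u}) (f : P ⟶ Q) (g : Q ⟶ R) (S : Spectrum P),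
      spectrumMap (f ≫ g) (hsel P R (f ≫ g)) S =
        spectrumMap g (hsel Q R g) (spectrumMap f (hsel P Q f) S)) :
    PCat.{u} ⥤ KCat.{u} where
  obj P := spectrumObj P (hobj P)
  map {P Q} f :=
    ConcreteCategory.ofHom (C := KCat.{u}) (X := spectrumObj P (hobj P))
      (Y := spectrumObj Q (hobj Q))
      (⟨spectrumMap f (hsel P Q f), hcont P Q f⟩ : C(Spectrum P, Spectrum Q))
  map_id P := by
    ext S
    exact hid P S
  map_comp {P Q R} f g := by
    ext S
    exact hcomp P Q R f g S

end PosetSpectrum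

/-! A point of the spectrum behaves like a neighbourhood filter. Each member p of a minimal selector
S is isolated by a cap meeting S in p alone; hence S is an up-set, and it is down-directed because
two caps of an ω-poset have a common refinement. By Zorn's lemma, caps are exactly the families
whose sets p^∈ cover the spectrum (`isCap_iff_forall_spectrum`). Finite subcaps then give
compactness, regularity gives the Hausdorff property, and countability gives metrisability.

Inclusion between minimal selectors is equality, so the functor laws and fullness each reduce to one
inclusion. A continuous φ is induced by the morphism with q ⊐ p iff φ(p^∈) ⊆ q^∈
(`homOfContinuous`).

For essential surjectivity, take finite open covers of a compact metric X with vanishing mesh, each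
refining the previous one. Pairs (level, set), ordered by deeper level together with inclusion, form
a poset whose caps are exactly the families covering X (`CoverSeq.isCap_iff`), so its minimal
selectors correspond to the points of X. -/

namespace PosetSpectrum

/-! ### Bands, caps and tiers in ω-posets -/

section OmegaPoset

variable {P : Type u} [PartialOrder P]

theorem IsBand.isCap {B : Set P} (hB : IsBand B) : IsCap B :=
  ⟨B, hB, fun b hb => ⟨b, hb, le_rfl⟩⟩

theorem IsCap.of_refines {C D : Set P} (hC : IsCap C) (h : Refines (· ≤ ·) C D) : IsCap D := by
  obtain ⟨B, hB, hBC⟩ := hC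
  refine ⟨B, hB, fun b hb => ?_⟩
  obtain ⟨c, hc, hbc⟩ := hBC b hb
  obtain ⟨d, hd, hcd⟩ := h c hc
  exact ⟨d, hd, le_trans hbc hcd⟩

theorem IsCap.mono {C D : Set P} (hC : IsCap C) (h : C ⊆ D) : IsCap D :=
  hC.of_refines fun c hc => ⟨c, h hc, le_rfl⟩

theorem IsCap.exists_finite_subset {C : Set P} (hC : IsCap C) :
    ∃ D ⊆ C, D.Finite ∧ IsCap D := by
  obtain ⟨B, hB, hBC⟩ := hC
  choose! f hf hle using hBC
  exact ⟨f '' B, Set.image_subset_iff.2 hf, hB.1.image f,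
    B, hB, fun b hb => ⟨f b, Set.mem_image_of_mem f hb, hle b hb⟩⟩

/-- The elements above which all strict chains have fewer than `n` members. -/
def tier (P : Type u) [PartialOrder P] : ℕ → Set P
  | 0 => ∅
  | n + 1 => {p | ∀ q, p < q → q ∈ tier P n}

theorem tier_subset_succ (n : ℕ) : tier P n ⊆ tier P (n + 1) := by
  induction n with
  | zero => exact Set.empty_subset _
  | succ n ih => exact fun p hp q hq => ih (hp q hq)

theorem tier_mono : Monotone (tier P) := monotone_nat_of_le_succ tier_subset_succ

theorem IsOmegaPoset.finite_tier (h : IsOmegaPoset P) (n : ℕ) : (tier P n).Finite := by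
  induction n with
  | zero => exact Set.finite_empty
  | succ n ih =>
    -- Above `p` there is only `p` itself and part of the finite tier `n`, which bounds the size of
    -- its principal filter.
    refine ((Set.finite_Iic ((tier P n).ncard + 1)).biUnion fun k _ => h.2 k).subset fun p hp => ?_
    refine Set.mem_biUnion (x := (Set.Ici p).ncard) ?_ rfl
    have hsub : Set.Ici p ⊆ insert p (tier P n) := fun q hq => by
      rcases eq_or_lt_of_le (show p ≤ q from hq) with rfl | hlt
      · exact Set.mem_insert _ _
      · exact Set.mem_insert_of_mem _ (hp q hlt)
    exact (Set.ncard_le_ncard hsub (ih.insert p)).trans (Set.ncard_insert_le p _)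

theorem IsOmegaPoset.mem_tier (h : IsOmegaPoset P) (p : P) : p ∈ tier P (Set.Ici p).ncard := by
  induction hn : (Set.Ici p).ncard using Nat.strong_induction_on generalizing p with
  | _ n ih =>
    have hpos : 0 < (Set.Ici p).ncard := (Set.ncard_pos (h.1 p)).2 ⟨p, Set.self_mem_Ici⟩
    obtain ⟨m, rfl⟩ : ∃ m, n = m + 1 := ⟨n - 1, by omega⟩
    intro q hq
    have hlt : (Set.Ici q).ncard < (Set.Ici p).ncard :=
      Set.ncard_lt_ncard (Set.Ici_ssubset_Ici.2 hq) (h.1 p)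
    exact tier_mono (by omega) (ih _ (by omega) q rfl)

theorem IsOmegaPoset.countable (h : IsOmegaPoset P) : Countable P := by
  rw [← Set.countable_univ_iff]
  refine (Set.countable_iUnion fun n => (h.finite_tier n).countable).mono fun p _ => ?_
  exact Set.mem_iUnion.2 ⟨_, h.mem_tier p⟩

theorem IsOmegaPoset.isBand_minimal_tier (h : IsOmegaPoset P) (n : ℕ) :
    IsBand {p | Minimal (· ∈ tier P (n + 1)) p} := by
  refine ⟨(h.finite_tier (n + 1)).subset fun p hp => hp.prop, fun p => ?_⟩
  by_cases hp : p ∈ tier P (n + 1)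
  · obtain ⟨b, hb, hmin⟩ := (h.finite_tier (n + 1)).exists_le_minimal hp
    exact ⟨b, hmin, Or.inl hb⟩
  -- Climb from `p` to a maximal `q` outside tier `n`. Everything strictly above `q` is in tier `n`,
  -- so `q` is in tier `n + 1`; an element of tier `n + 1` strictly below `q` would put `q` in tier
  -- `n`.
  · have hfin : {q | p ≤ q ∧ q ∉ tier P n}.Finite := (h.1 p).subset fun q hq => hq.1
    have hmem : p ∈ {q | p ≤ q ∧ q ∉ tier P n} :=
      ⟨le_rfl, fun hn => hp (tier_subset_succ n hn)⟩
    obtain ⟨q, hpq, hq⟩ := hfin.exists_le_maximal hmem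
    refine ⟨q, ⟨fun r hr => ?_, fun r hr hrq => ?_⟩, Or.inr hpq⟩
    · by_contra hrn
      exact hr.not_ge (hq.2 ⟨hpq.trans hr.le, hrn⟩ hr.le)
    · rcases eq_or_lt_of_le hrq with rfl | hlt
      · exact le_rfl
      · exact absurd (hr q hlt) hq.prop.2

/-- Both finite bands lie in one tier. A minimal element p of the next tier comparable to a member b
of a band satisfies p ≤ b, by minimality if b ≤ p, so these minimal elements refine both bands. -/
theorem IsOmegaPoset.exists_isCap_refines (h : IsOmegaPoset P) {C D : Set P} (hC : IsCap C)
    (hD : IsCap D) : ∃ E : Set P, IsCap E ∧ Refines (· ≤ ·) E C ∧ Refines (· ≤ ·) E D := by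
  obtain ⟨A, hA, hAC⟩ := hC
  obtain ⟨B, hB, hBD⟩ := hD
  obtain ⟨n, hn⟩ : ∃ n, A ∪ B ⊆ tier P n := by
    obtain ⟨n, hn⟩ := ((hA.1.union hB.1).image fun p : P => (Set.Ici p).ncard).bddAbove
    exact ⟨n, fun p hp => tier_mono (hn (Set.mem_image_of_mem _ hp)) (h.mem_tier p)⟩
  have key : ∀ B' C' : Set P, IsBand B' → B' ⊆ A ∪ B → Refines (· ≤ ·) B' C' →
      Refines (· ≤ ·) {p | Minimal (· ∈ tier P (n + 1)) p} C' := by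
    intro B' C' hB' hsub href p hp
    obtain ⟨b, hb, hbp⟩ := hB'.2 p
    obtain ⟨c, hc, hbc⟩ := href b hb
    refine ⟨c, hc, le_trans ?_ hbc⟩
    rcases hbp with hbp | hbp
    · exact hp.2 (tier_subset_succ n (hn (hsub hb))) hbp
    · exact hbp
  exact ⟨_, (h.isBand_minimal_tier n).isCap, key A C hA Set.subset_union_left hAC,
    key B D hB Set.subset_union_right hBD⟩

end OmegaPoset

/-! ### Minimal selectors -/

section Selector

variable {P : Type u} [PartialOrder P]

/-- Zorn applies because every cap contains a finite cap: if the intersection of a chain missed it,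
a single member of the chain would already miss it. -/
theorem IsSelector.exists_minimal_subset {S : Set P} (hS : IsSelector S) :
    ∃ T ⊆ S, Minimal IsSelector T := by
  refine zorn_superset_nonempty {S : Set P | IsSelector S} ?_ S hS
  intro c hc hchain hne
  refine ⟨⋂₀ c, fun C hC => ?_, fun s hs => Set.sInter_subset_of_mem hs⟩
  obtain ⟨D, hDC, hDfin, hD⟩ := hC.exists_finite_subset
  by_contra hempty
  have hmiss : ∀ d ∈ D, ∃ s ∈ c, d ∉ s := by
    intro d hd
    by_contra! hall
    exact hempty ⟨d, hall, hDC hd⟩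
  choose! f hfc hf using hmiss
  have hdir : ∀ s ∈ c, ∀ t ∈ c, ∃ r ∈ c, r ⊆ s ∧ r ⊆ t := fun s hs t ht => by
    rcases hchain.total hs ht with h | h
    · exact ⟨s, hs, Set.Subset.rfl, h⟩
    · exact ⟨t, ht, h, Set.Subset.rfl⟩
  obtain ⟨s₀, hs₀⟩ := hne
  obtain ⟨s, hs, hsub⟩ : ∃ s ∈ c, ∀ d ∈ D, s ⊆ f d := by
    clear hf hD hDC
    induction D, hDfin using Set.Finite.induction_on with
    | empty => exact ⟨s₀, hs₀, by simp⟩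
    | @insert a D _ _ ih =>
      obtain ⟨s, hs, hsD⟩ := ih fun d hd => hfc d (Set.mem_insert_of_mem _ hd)
      obtain ⟨t, ht, hts, hta⟩ := hdir s hs (f a) (hfc a (Set.mem_insert _ _))
      refine ⟨t, ht, ?_⟩
      rintro d (rfl | hd)
      · exact hta
      · exact Set.Subset.trans hts (hsD d hd)
  obtain ⟨d, hds, hdD⟩ := hc hs D hD
  exact hf d hdD (hsub d hdD hds)

/-- Supersets of caps are caps, so the complement of a non-cap is a selector and contains a minimal
one. -/
theorem isCap_iff_forall_spectrum {C : Set P} :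
    IsCap C ↔ ∀ S : Spectrum P, (S.1 ∩ C).Nonempty := by
  refine ⟨fun hC S => S.2.prop C hC, fun h => ?_⟩
  by_contra hC
  have hsel : IsSelector Cᶜ := by
    intro D hD
    by_contra hempty
    refine hC (hD.mono fun d hd => ?_)
    by_contra hdC
    exact hempty ⟨d, hdC, hd⟩
  obtain ⟨T, hTC, hT⟩ := hsel.exists_minimal_subset
  obtain ⟨p, hpT, hpC⟩ := h ⟨T, hT⟩
  exact hTC hpT hpC

theorem exists_isCap_inter_eq_singleton {S : Set P} (hS : Minimal IsSelector S) {p : P}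
    (hp : p ∈ S) : ∃ C : Set P, IsCap C ∧ ∀ c ∈ C, c ∈ S → c = p := by
  by_contra! hall
  have hsel : IsSelector (S \ {p}) := by
    intro C hC
    obtain ⟨c, hcC, hcS, hcp⟩ := hall C hC
    exact ⟨c, ⟨hcS, hcp⟩, hcC⟩
  exact (hS.2 hsel Set.sdiff_subset hp).2 rfl

theorem Spectrum.isUpperSet (S : Spectrum P) : IsUpperSet S.1 := by
  intro p q hpq hp
  obtain ⟨C, hC, hCp⟩ := exists_isCap_inter_eq_singleton S.2 hp
  -- Replacing `p` by `q` in the isolating cap leaves `q` as the only element that `S` can meet.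
  have hD : IsCap ((C \ {p}) ∪ {q}) := hC.of_refines fun c hc => by
    by_cases hcp : c = p
    · exact ⟨q, Or.inr rfl, hcp ▸ hpq⟩
    · exact ⟨c, Or.inl ⟨hc, hcp⟩, le_rfl⟩
  obtain ⟨d, hdS, hd | rfl⟩ := S.2.prop _ hD
  · exact absurd (hCp d hd.1 hdS) hd.2
  · exact hdS

theorem Spectrum.eq_of_subset {S T : Spectrum P} (h : S.1 ⊆ T.1) : S = T :=
  Subtype.ext (h.antisymm (T.2.2 S.2.prop h))

/-- A common refinement of the caps isolating p and q meets S, and the elements above the meeting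
point must be p and q. -/
theorem Spectrum.exists_le_le (h : IsOmegaPoset P) (S : Spectrum P) {p q : P} (hp : p ∈ S.1)
    (hq : q ∈ S.1) : ∃ r ∈ S.1, r ≤ p ∧ r ≤ q := by
  obtain ⟨C, hC, hCp⟩ := exists_isCap_inter_eq_singleton S.2 hp
  obtain ⟨D, hD, hDq⟩ := exists_isCap_inter_eq_singleton S.2 hq
  obtain ⟨E, hE, hEC, hED⟩ := h.exists_isCap_refines hC hD
  obtain ⟨e, heS, he⟩ := S.2.prop E hE
  obtain ⟨c, hc, hec⟩ := hEC e he
  obtain ⟨d, hd, hed⟩ := hED e he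
  obtain rfl := hCp c hc (S.isUpperSet hec heS)
  obtain rfl := hDq d hd (S.isUpperSet hed heS)
  exact ⟨e, heS, hec, hed⟩

theorem Spectrum.wedge (h : IsOmegaPoset P) (S : Spectrum P) {p q : P} (hp : p ∈ S.1)
    (hq : q ∈ S.1) : Wedge p q := by
  obtain ⟨r, -, hrp, hrq⟩ := S.exists_le_le h hp hq
  exact ⟨r, hrp, hrq⟩

theorem IsPrimePoset.exists_mem_mem (h : IsPrimePoset P) {p q : P} (hpq : Wedge p q) :
    ∃ S : Spectrum P, p ∈ S.1 ∧ q ∈ S.1 := by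
  obtain ⟨r, hrp, hrq⟩ := hpq
  obtain ⟨S, hS⟩ := h r
  exact ⟨S, S.isUpperSet hrp hS, S.isUpperSet hrq hS⟩

theorem Spectrum.mem_of_starBelow (h : IsOmegaPoset P) (S : Spectrum P) {p q : P}
    (hpq : StarBelow p q) (hp : p ∈ S.1) : q ∈ S.1 := by
  obtain ⟨C, hC, hCq⟩ := hpq
  obtain ⟨c, hcS, hc⟩ := S.2.prop C hC
  exact S.isUpperSet (hCq c ⟨hc, S.wedge h hp hcS⟩) hcS

theorem Spectrum.exists_starBelow (h : IsRegularPoset P) (S : Spectrum P) {p : P}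
    (ho : IsOmegaPoset P) (hp : p ∈ S.1) : ∃ q ∈ S.1, StarBelow q p := by
  obtain ⟨C, hC, hCp⟩ := exists_isCap_inter_eq_singleton S.2 hp
  obtain ⟨D, hD, hDC⟩ := h C hC
  obtain ⟨d, hdS, hd⟩ := S.2.prop D hD
  obtain ⟨c, hc, hdc⟩ := hDC d hd
  obtain rfl := hCp c hc (S.mem_of_starBelow ho hdc hdS)
  exact ⟨d, hdS, hdc⟩

theorem wedge_of_starBelow (ho : IsOmegaPoset P) (hp : IsPrimePoset P) {p q r : P}
    (hpr : Wedge p r) (hpq : StarBelow p q) : Wedge q r := by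
  obtain ⟨S, hpS, hrS⟩ := hp.exists_mem_mem hpr
  exact S.wedge ho (S.mem_of_starBelow ho hpq hpS) hrS

end Selector

/-! ### Topology of the spectrum -/

section Topology

variable {P : Type u} [PartialOrder P]

theorem isOpen_setOf_mem (p : P) : IsOpen {S : Spectrum P | p ∈ S.1} :=
  TopologicalSpace.isOpen_generateFrom_of_mem ⟨p, rfl⟩

/-- By Alexander's subbase theorem only subbasic covers matter; these are caps, and a finite subcap
is a finite subcover. -/
instance : CompactSpace (Spectrum P) := by
  refine compactSpace_generateFrom rfl fun 𝒰 h𝒰 hcov => ?_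
  have hC : IsCap {p : P | {S : Spectrum P | p ∈ S.1} ∈ 𝒰} := by
    rw [isCap_iff_forall_spectrum]
    intro S
    obtain ⟨U, hU, hSU⟩ : S ∈ ⋃₀ 𝒰 := hcov ▸ Set.mem_univ S
    obtain ⟨p, rfl⟩ := h𝒰 hU
    exact ⟨p, hSU, hU⟩
  obtain ⟨D, hDC, hDfin, hD⟩ := hC.exists_finite_subset
  refine ⟨(fun p => {S : Spectrum P | p ∈ S.1}) '' D, Set.image_subset_iff.2 hDC,
    hDfin.image _, Set.eq_univ_of_forall fun S => ?_⟩
  obtain ⟨d, hdS, hd⟩ := S.2.prop D hD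
  exact ⟨_, Set.mem_image_of_mem _ hd, hdS⟩

theorem t2Space_spectrum (ho : IsOmegaPoset P) (hr : IsRegularPoset P) :
    T2Space (Spectrum P) := by
  refine ⟨fun S T hST => ?_⟩
  obtain ⟨p, hpS, hpT⟩ : ∃ p ∈ S.1, p ∉ T.1 := by
    by_contra! hsub
    exact hST (Spectrum.eq_of_subset hsub)
  obtain ⟨q, hqS, C, hC, hCp⟩ := S.exists_starBelow hr ho hpS
  -- `q^∈` and `c^∈` are disjoint: a common point would give `c ∧ q`, hence `c ≤ p` and `p ∈ T`.
  obtain ⟨c, hcT, hc⟩ := T.2.prop C hC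
  refine ⟨_, _, isOpen_setOf_mem q, isOpen_setOf_mem c, hqS, hcT, ?_⟩
  rw [Set.disjoint_left]
  intro U hqU hcU
  exact hpT (T.isUpperSet (hCp c ⟨hc, U.wedge ho hqU hcU⟩) hcT)

theorem metrizableSpace_spectrum (ho : IsOmegaPoset P) (hr : IsRegularPoset P) :
    TopologicalSpace.MetrizableSpace (Spectrum P) := by
  have := t2Space_spectrum ho hr
  have := ho.countable
  have : SecondCountableTopology (Spectrum P) := ⟨_, Set.countable_range _, rfl⟩
  exact TopologicalSpace.metrizableSpace_of_t3_secondCountable _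

/-- Down-directedness of S turns the subbasis into a basis. -/
theorem exists_mem_subset_of_isOpen (ho : IsOmegaPoset P) {U : Set (Spectrum P)} (hU : IsOpen U)
    {S : Spectrum P} (hS : S ∈ U) : ∃ p ∈ S.1, {T : Spectrum P | p ∈ T.1} ⊆ U := by
  induction hU with
  | basic V hV =>
    obtain ⟨p, rfl⟩ := hV
    exact ⟨p, hS, Set.Subset.rfl⟩
  | univ =>
    obtain ⟨p, hp, -⟩ := S.2.prop _ (ho.isBand_minimal_tier 0).isCap
    exact ⟨p, hp, Set.subset_univ _⟩
  | inter V W _ _ ihV ihW =>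
    obtain ⟨p, hp, hpV⟩ := ihV hS.1
    obtain ⟨q, hq, hqW⟩ := ihW hS.2
    obtain ⟨r, hr, hrp, hrq⟩ := S.exists_le_le ho hp hq
    exact ⟨r, hr, fun T hT => ⟨hpV (T.isUpperSet hrp hT), hqW (T.isUpperSet hrq hT)⟩⟩
  | sUnion 𝒱 _ ih =>
    obtain ⟨V, hV, hSV⟩ := hS
    obtain ⟨p, hp, hpV⟩ := ih V hV hSV
    exact ⟨p, hp, hpV.trans (Set.subset_sUnion_of_mem hV)⟩

end Topology

/-! ### Maps of spectra and fullness -/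

section Morphism

theorem minimal_starImage (P Q : PCat.{u}) (f : P ⟶ Q) (S : Spectrum P) :
    Minimal IsSelector (starImage f.rel S.1) := by
  have hsel : IsSelector (upImage (flip f.rel) S.1) := by
    intro D hD
    obtain ⟨C, hC, hCD⟩ := f.refiner D hD
    obtain ⟨c, hcS, hc⟩ := S.2.prop C hC
    obtain ⟨d, hd, hcd⟩ := hCD c hc
    exact ⟨d, ⟨c, hcS, hcd⟩, hd⟩
  refine ⟨fun D hD => ?_, fun M hM hMT q hq => ?_⟩
  · obtain ⟨E, hE, hED⟩ := Q.regular D hD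
    obtain ⟨e, he, heE⟩ := hsel E hE
    obtain ⟨d, hd, hed⟩ := hED e heE
    exact ⟨d, ⟨e, he, hed⟩, hd⟩
  · obtain ⟨N, hNM, hN⟩ := IsSelector.exists_minimal_subset hM
    obtain ⟨q', ⟨p, hp, hqp⟩, E, hE, hEq⟩ := hq
    -- The cap `E` witnesses `q' ◁ q`, so it suffices that `e ∧ q'`: then `e ≤ q` and `q ∈ N`. The
    -- wedge comes from two members of `S`, carried across by ∧-preservation and then by `e' ◁ e`.
    obtain ⟨e, heN, he⟩ := hN.prop E hE
    obtain ⟨e', ⟨p', hp', hep⟩, hee⟩ := hMT (hNM heN)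
    have hw : Wedge e' q' := f.wedge p' p e' q' hep (S.wedge P.omega hp' hp) hqp
    obtain ⟨r, hre, hrq⟩ := wedge_of_starBelow Q.omega Q.prime hw hee
    exact hNM (Spectrum.isUpperSet ⟨N, hN⟩ (hEq e ⟨he, r, hrq, hre⟩) heN)

theorem continuous_spectrumMap (P Q : PCat.{u}) (f : P ⟶ Q) :
    Continuous (spectrumMap f (minimal_starImage P Q f)) := by
  refine continuous_generateFrom_iff.2 ?_
  rintro _ ⟨q, rfl⟩
  have heq : spectrumMap f (minimal_starImage P Q f) ⁻¹' {T : Spectrum Q | q ∈ T.1} =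
      ⋃ (p : P) (_ : ∃ q', f.rel q' p ∧ StarBelow q' q), {S : Spectrum P | p ∈ S.1} := by
    ext S
    simp only [Set.mem_preimage, Set.mem_ofPred_eq, Set.mem_iUnion]
    constructor
    · rintro ⟨q', ⟨p, hp, hqp⟩, hq⟩
      exact ⟨p, ⟨q', hqp, hq⟩, hp⟩
    · rintro ⟨p, ⟨q', hqp, hq⟩, hp⟩
      exact ⟨q', ⟨p, hp, hqp⟩, hq⟩
  rw [heq]
  exact isOpen_iUnion fun p => isOpen_iUnion fun _ => isOpen_setOf_mem p

theorem spectrumMap_id (P : PCat.{u}) (S : Spectrum P) :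
    spectrumMap (𝟙 P) (minimal_starImage P P (𝟙 P)) S = S := by
  refine Spectrum.eq_of_subset ?_
  rintro q ⟨_, ⟨p, hp, rfl⟩, hq⟩
  exact S.mem_of_starBelow P.omega hq hp

theorem spectrumMap_comp (P Q R : PCat.{u}) (f : P ⟶ Q) (g : Q ⟶ R) (S : Spectrum P) :
    spectrumMap (f ≫ g) (minimal_starImage P R (f ≫ g)) S =
      spectrumMap g (minimal_starImage Q R g) (spectrumMap f (minimal_starImage P Q f) S) := by
  refine Spectrum.eq_of_subset ?_
  rintro y ⟨y', ⟨p, hp, q, hyq, hqp⟩, E, hE, hEy⟩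
  set U := spectrumMap g (minimal_starImage Q R g) (spectrumMap f (minimal_starImage P Q f) S)
  obtain ⟨e, heU, he⟩ := U.2.prop E hE
  obtain ⟨x, ⟨t, ⟨t', ⟨p', hp', htp⟩, htt⟩, hxt⟩, hxe⟩ := id heU
  -- The same argument with two relations: `t ∧ q` is transported to `e ∧ y'`, whence `e ≤ y`.
  have htq : Wedge t q := wedge_of_starBelow Q.omega Q.prime
    (f.wedge p' p t' q htp (S.wedge P.omega hp' hp) hqp) htt
  obtain ⟨r, hre, hry⟩ := wedge_of_starBelow R.omega R.prime (g.wedge t q x y' hxt htq hyq) hxe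
  exact U.isUpperSet (hEy e ⟨he, r, hry, hre⟩) heU

/-- The relation `q ⊐ p ↔ φ(p^∈) ⊆ q^∈` induced by a continuous map of spectra. -/
def homOfContinuous {P Q : PCat.{u}} (φ : Spectrum P → Spectrum Q) (hφ : Continuous φ) :
    PCat.Hom P Q where
  rel q p := ∀ S : Spectrum P, p ∈ S.1 → q ∈ (φ S).1
  refiner D hD := by
    refine ⟨{p | ∃ d ∈ D, ∀ S : Spectrum P, p ∈ S.1 → d ∈ (φ S).1}, ?_, fun p hp => hp⟩
    rw [isCap_iff_forall_spectrum]
    intro S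
    obtain ⟨d, hdS, hd⟩ := (φ S).2.prop D hD
    obtain ⟨p, hp, hsub⟩ :=
      exists_mem_subset_of_isOpen P.omega ((isOpen_setOf_mem d).preimage hφ) (S := S) hdS
    exact ⟨p, hp, d, hd, fun T hT => hsub hT⟩
  wedge := by
    intro p p' q q' hqp hw hqp'
    obtain ⟨S, hS, hS'⟩ := P.prime.exists_mem_mem hw
    exact (φ S).wedge Q.omega (hqp S hS) (hqp' S hS')

theorem spectrumMap_homOfContinuous {P Q : PCat.{u}} (φ : Spectrum P → Spectrum Q)
    (hφ : Continuous φ) (S : Spectrum P) :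
    spectrumMap (P := P) (Q := Q) (homOfContinuous φ hφ)
      (minimal_starImage P Q (homOfContinuous φ hφ)) S = φ S := by
  refine Spectrum.eq_of_subset ?_
  rintro q ⟨q', ⟨p, hp, hqp⟩, hq⟩
  exact (φ S).mem_of_starBelow Q.omega hq (hqp S hp)

end Morphism

/-! ### Every compact metric space is a spectrum -/

section CoverPoset

open Metric

/-- A sequence of finite covers of `X` by non-empty open sets, with mesh tending to zero, in which
every cover refines the previous one and every member of a cover contains a member of the next
one. -/
structure CoverSeq (X : Type u) [MetricSpace X] where
  cover : ℕ → Set (Set X)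
  finite : ∀ n, (cover n).Finite
  isOpen : ∀ n, ∀ U ∈ cover n, IsOpen U
  nonempty : ∀ n, ∀ U ∈ cover n, U.Nonempty
  exists_mem : ∀ n x, ∃ U ∈ cover n, x ∈ U
  exists_superset : ∀ n, ∀ V ∈ cover (n + 1), ∃ U ∈ cover n, V ⊆ U
  exists_subset : ∀ n, ∀ U ∈ cover n, ∃ V ∈ cover (n + 1), V ⊆ U
  subset_ball : ∀ n, ∀ V ∈ cover (n + 1), ∀ x ∈ V, V ⊆ ball x (1 / ((n : ℝ) + 1))

variable {X : Type u} [MetricSpace X]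

/-- Finitely many balls cover X; one more ball inside each old set ensures that every old set
contains a new one. Radii at most ε/2 bound the mesh by ε. -/
theorem exists_finite_refining_cover [CompactSpace X] {𝒞 : Set (Set X)} (hfin : 𝒞.Finite)
    (hopen : ∀ U ∈ 𝒞, IsOpen U) (hne : ∀ U ∈ 𝒞, U.Nonempty) (hcov : ∀ x, ∃ U ∈ 𝒞, x ∈ U)
    {ε : ℝ} (hε : 0 < ε) :
    ∃ 𝒟 : Set (Set X), (𝒟.Finite ∧ (∀ V ∈ 𝒟, IsOpen V) ∧ (∀ V ∈ 𝒟, V.Nonempty) ∧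
      ∀ x, ∃ V ∈ 𝒟, x ∈ V) ∧ (∀ V ∈ 𝒟, ∃ U ∈ 𝒞, V ⊆ U) ∧ (∀ U ∈ 𝒞, ∃ V ∈ 𝒟, V ⊆ U) ∧
      ∀ V ∈ 𝒟, ∀ x ∈ V, V ⊆ ball x ε := by
  have hsmall : ∀ U ∈ 𝒞, ∀ x ∈ U, ∃ δ > 0, ball x δ ⊆ U ∧ δ ≤ ε / 2 := by
    intro U hU x hx
    obtain ⟨δ, hδ, hsub⟩ := isOpen_iff.1 (hopen U hU) x hx
    exact ⟨min δ (ε / 2), lt_min hδ (half_pos hε),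
      (ball_subset_ball (min_le_left _ _)).trans hsub, min_le_right _ _⟩
  have hcenter : ∀ x, ∃ δ > 0, (∃ U ∈ 𝒞, ball x δ ⊆ U) ∧ δ ≤ ε / 2 := by
    intro x
    obtain ⟨U, hU, hx⟩ := hcov x
    obtain ⟨δ, hδ, hsub, hle⟩ := hsmall U hU x hx
    exact ⟨δ, hδ, ⟨U, hU, hsub⟩, hle⟩
  choose δ hδ hδsub hδle using hcenter
  have hpoint : ∀ U ∈ 𝒞, ∃ x, ∃ ρ > 0, ball x ρ ⊆ U ∧ ρ ≤ ε / 2 := by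
    intro U hU
    obtain ⟨x, hx⟩ := hne U hU
    exact ⟨x, hsmall U hU x hx⟩
  choose c ρ hρ hρsub hρle using hpoint
  obtain ⟨t, ht⟩ := isCompact_univ.elim_finite_subcover (fun x => ball x (δ x))
    (fun x => isOpen_ball) fun x _ => Set.mem_iUnion.2 ⟨x, mem_ball_self (hδ x)⟩
  have hform : ∀ V ∈ (fun x => ball x (δ x)) '' (t : Set X) ∪ Set.range (fun U : 𝒞 => ball (c U.1 U.2) (ρ U.1 U.2)),
      ∃ x r, V = ball x r ∧ 0 < r ∧ r ≤ ε / 2 ∧ ∃ U ∈ 𝒞, V ⊆ U := by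
    rintro V (⟨x, -, rfl⟩ | ⟨⟨U, hU⟩, rfl⟩)
    · exact ⟨x, δ x, rfl, hδ x, hδle x, hδsub x⟩
    · exact ⟨c U hU, ρ U hU, rfl, hρ U hU, hρle U hU, U, hU, hρsub U hU⟩
  refine ⟨(fun x => ball x (δ x)) '' (t : Set X) ∪
    Set.range (fun U : 𝒞 => ball (c U.1 U.2) (ρ U.1 U.2)), ⟨(t.finite_toSet.image _).union (@Set.finite_range _ _ _ hfin),
    fun V hV => ?_, fun V hV => ?_,
    fun x => ?_⟩, fun V hV => ?_,
    fun U hU => ⟨ball (c U hU) (ρ U hU), Or.inr ⟨⟨U, hU⟩, rfl⟩, hρsub U hU⟩, fun V hV x hx y hy => ?_⟩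
  · obtain ⟨x, r, rfl, -⟩ := hform V hV
    exact isOpen_ball
  · obtain ⟨x, r, rfl, hr, -⟩ := hform V hV
    exact ⟨x, mem_ball_self hr⟩
  · obtain ⟨y, hy, hx⟩ := Set.mem_iUnion₂.1 (ht (Set.mem_univ x))
    exact ⟨_, Or.inl (Set.mem_image_of_mem _ hy), hx⟩
  · obtain ⟨-, -, -, -, -, hU⟩ := hform V hV
    exact hU
  · obtain ⟨z, r, rfl, -, hr, -⟩ := hform V hV
    have htri := dist_triangle_right y x z
    rw [mem_ball] at hx hy ⊢
    linarith

theorem nonempty_coverSeq (X : Type u) [MetricSpace X] [CompactSpace X] :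
    Nonempty (CoverSeq X) := by
  let G := {𝒞 : Set (Set X) // 𝒞.Finite ∧ (∀ U ∈ 𝒞, IsOpen U) ∧ (∀ U ∈ 𝒞, U.Nonempty) ∧
    ∀ x, ∃ U ∈ 𝒞, x ∈ U}
  have hstep : ∀ (n : ℕ) (𝒞 : G), ∃ 𝒟 : G, (∀ V ∈ 𝒟.1, ∃ U ∈ 𝒞.1, V ⊆ U) ∧
      (∀ U ∈ 𝒞.1, ∃ V ∈ 𝒟.1, V ⊆ U) ∧ ∀ V ∈ 𝒟.1, ∀ x ∈ V, V ⊆ ball x (1 / ((n : ℝ) + 1)) := by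
    intro n 𝒞
    obtain ⟨𝒟, h𝒟, h⟩ := exists_finite_refining_cover 𝒞.2.1 𝒞.2.2.1 𝒞.2.2.2.1 𝒞.2.2.2.2
      (Nat.one_div_pos_of_nat (α := ℝ) (n := n))
    exact ⟨⟨𝒟, h𝒟⟩, h⟩
  choose next hsup hsub hball using hstep
  -- This family is empty when `X` is empty, as its members must be non-empty.
  let start : G := ⟨{U | U = Set.univ ∧ U.Nonempty},
    (Set.finite_singleton Set.univ).subset fun U hU => hU.1, fun U hU => hU.1 ▸ isOpen_univ,
    fun U hU => hU.2, fun x => ⟨Set.univ, ⟨rfl, x, trivial⟩, trivial⟩⟩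
  let seq : ℕ → G := fun n => Nat.rec start next n
  exact ⟨{ cover := fun n => (seq n).1
           finite := fun n => (seq n).2.1
           isOpen := fun n => (seq n).2.2.1
           nonempty := fun n => (seq n).2.2.2.1
           exists_mem := fun n => (seq n).2.2.2.2
           exists_superset := fun n => hsup n (seq n)
           exists_subset := fun n => hsub n (seq n)
           subset_ball := fun n => hball n (seq n) }⟩

/-! ### The poset of a sequence of covers -/

namespace CoverSeq

variable (𝒞 : CoverSeq X)

/-- The pairs of an index and a member of the cover with that index. -/
def Elt : Type u := {p : ℕ × Set X // p.2 ∈ 𝒞.cover p.1}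

variable {𝒞}

/-- The index of the cover that an element is taken from. -/
def Elt.level (p : 𝒞.Elt) : ℕ := p.1.1

/-- The open set underlying an element. -/
def Elt.set (p : 𝒞.Elt) : Set X := p.1.2

theorem Elt.mem_cover (p : 𝒞.Elt) : p.set ∈ 𝒞.cover p.level := p.2

theorem Elt.isOpen (p : 𝒞.Elt) : IsOpen p.set := 𝒞.isOpen _ _ p.mem_cover

theorem Elt.nonempty (p : 𝒞.Elt) : p.set.Nonempty := 𝒞.nonempty _ _ p.mem_cover

/-- An element lies strictly below another if its level is larger and its set is smaller. -/
instance : PartialOrder 𝒞.Elt where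
  le p q := p = q ∨ q.level < p.level ∧ p.set ⊆ q.set
  le_refl p := Or.inl rfl
  le_trans := by
    rintro p q r (rfl | ⟨hpq, hpq'⟩) (rfl | ⟨hqr, hqr'⟩)
    · exact Or.inl rfl
    · exact Or.inr ⟨hqr, hqr'⟩
    · exact Or.inr ⟨hpq, hpq'⟩
    · exact Or.inr ⟨hqr.trans hpq, hpq'.trans hqr'⟩
  le_antisymm := by
    rintro p q (h | h) (h' | h')
    · exact h
    · exact h
    · exact h'.symm
    · exact absurd h.1 h'.1.asymm

theorem Elt.le_of_subset {p q : 𝒞.Elt} (hl : q.level < p.level) (hs : p.set ⊆ q.set) : p ≤ q :=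
  Or.inr ⟨hl, hs⟩

theorem Elt.set_subset {p q : 𝒞.Elt} (h : p ≤ q) : p.set ⊆ q.set := by
  rcases h with rfl | h
  · exact Set.Subset.rfl
  · exact h.2

theorem Elt.level_le {p q : 𝒞.Elt} (h : p ≤ q) : q.level ≤ p.level := by
  rcases h with rfl | h
  · exact le_rfl
  · exact h.1.le

theorem finite_level_le (n : ℕ) : {p : 𝒞.Elt | p.level ≤ n}.Finite := by
  have hfin : (⋃ k ∈ Set.Iic n, Prod.mk k '' 𝒞.cover k).Finite :=
    (Set.finite_Iic n).biUnion fun k _ => (𝒞.finite k).image _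
  refine (hfin.preimage (f := Subtype.val) Subtype.val_injective.injOn).subset fun p hp => ?_
  exact Set.mem_biUnion (x := Elt.level p) hp ⟨Elt.set p, Elt.mem_cover p, rfl⟩

theorem Elt.exists_ge (p : 𝒞.Elt) {n : ℕ} (hn : n ≤ p.level) :
    ∃ q : 𝒞.Elt, q.level = n ∧ p ≤ q := by
  induction hn using Nat.decreasingInduction with
  | self => exact ⟨p, rfl, le_rfl⟩
  | of_succ k _ ih =>
    obtain ⟨q, hq, hpq⟩ := ih
    obtain ⟨U, hU, hqU⟩ := 𝒞.exists_superset k q.set (hq ▸ q.mem_cover)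
    refine ⟨⟨(k, U), hU⟩, rfl, hpq.trans (le_of_subset ?_ hqU)⟩
    rw [hq]
    exact k.lt_succ_self

theorem Elt.exists_le (p : 𝒞.Elt) {n : ℕ} (hn : p.level ≤ n) :
    ∃ q : 𝒞.Elt, q.level = n ∧ q ≤ p := by
  induction n, hn using Nat.le_induction with
  | base => exact ⟨p, rfl, le_rfl⟩
  | succ k _ ih =>
    obtain ⟨q, rfl, hqp⟩ := ih
    obtain ⟨V, hV, hVq⟩ := 𝒞.exists_subset _ q.set q.mem_cover
    exact ⟨⟨(q.level + 1, V), hV⟩, rfl,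
      le_trans (le_of_subset q.level.lt_succ_self hVq) hqp⟩

theorem isBand_level (n : ℕ) : IsBand {p : 𝒞.Elt | p.level = n} := by
  refine ⟨(finite_level_le n).subset fun p hp => le_of_eq hp, fun p => ?_⟩
  rcases le_total n p.level with h | h
  · obtain ⟨q, hq, hpq⟩ := p.exists_ge h
    exact ⟨q, hq, Or.inr hpq⟩
  · obtain ⟨q, hq, hqp⟩ := p.exists_le h
    exact ⟨q, hq, Or.inl hqp⟩

theorem exists_small_mesh {ε : ℝ} (hε : 0 < ε) (m : ℕ) :
    ∃ n > m, ∀ p : 𝒞.Elt, p.level = n → ∀ x ∈ p.set, p.set ⊆ ball x ε := by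
  obtain ⟨k, hk⟩ := exists_nat_one_div_lt hε
  refine ⟨max k m + 1, by omega, fun p hp x hx => ?_⟩
  refine (𝒞.subset_ball _ p.set (hp ▸ p.mem_cover) x hx).trans (ball_subset_ball ?_)
  refine le_trans (one_div_le_one_div_of_le (by positivity) ?_) hk.le
  have : (k : ℝ) ≤ (max k m : ℕ) := by exact_mod_cast le_max_left k m
  linarith

theorem exists_elt_subset {x : X} {U : Set X} (hU : IsOpen U) (hx : x ∈ U) (m : ℕ) :
    ∃ p : 𝒞.Elt, m < p.level ∧ x ∈ p.set ∧ p.set ⊆ U := by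
  obtain ⟨ε, hε, hball⟩ := isOpen_iff.1 hU x hx
  obtain ⟨n, hn, hmesh⟩ := exists_small_mesh (𝒞 := 𝒞) hε m
  obtain ⟨V, hV, hxV⟩ := 𝒞.exists_mem n x
  exact ⟨⟨(n, V), hV⟩, hn, hxV, (hmesh ⟨(n, V), hV⟩ rfl x hxV).trans hball⟩

/-- A level deeper than a band can only lie below it, so caps cover. Conversely, a level finer than
a Lebesgue number of a finite subcover, and deeper than its members, refines it. -/
theorem isCap_iff [CompactSpace X] {C : Set 𝒞.Elt} :
    IsCap C ↔ ∀ x : X, ∃ c ∈ C, x ∈ c.set := by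
  constructor
  · rintro ⟨B, ⟨hfin, hB⟩, hBC⟩ x
    obtain ⟨n, hn⟩ := (hfin.image Elt.level).bddAbove
    obtain ⟨U, hU, hx⟩ := 𝒞.exists_mem (n + 1) x
    obtain ⟨b, hb, hbp⟩ := hB ⟨(n + 1, U), hU⟩
    obtain ⟨c, hc, hbc⟩ := hBC b hb
    refine ⟨c, hc, Elt.set_subset hbc ?_⟩
    rcases hbp with hbp | hbp
    · exact absurd (hn (Set.mem_image_of_mem _ hb)) (Nat.not_le.2 (Elt.level_le hbp))
    · exact Elt.set_subset hbp hx
  · intro hcov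
    obtain ⟨t, ht⟩ := isCompact_univ.elim_finite_subcover (fun c : C => c.1.set)
      (fun c => c.1.isOpen) fun x _ => by
        obtain ⟨c, hc, hx⟩ := hcov x
        exact Set.mem_iUnion.2 ⟨⟨c, hc⟩, hx⟩
    obtain ⟨ε, hε, hleb⟩ := lebesgue_number_lemma_of_metric (c := fun c : t => c.1.1.set)
      isCompact_univ (fun c => c.1.1.isOpen) (by simpa [Set.iUnion_subtype] using ht)
    obtain ⟨m, hm⟩ := (t.finite_toSet.image fun c : C => c.1.level).bddAbove
    obtain ⟨n, hn, hmesh⟩ := exists_small_mesh (𝒞 := 𝒞) hε m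
    refine ⟨_, isBand_level n, fun p hp => ?_⟩
    obtain ⟨x, hx⟩ := p.nonempty
    obtain ⟨c, hc⟩ := hleb x trivial
    refine ⟨c.1.1, c.1.2, Elt.le_of_subset ?_ ((hmesh p hp x hx).trans hc)⟩
    rw [show p.level = n from hp]
    exact (hm (Set.mem_image_of_mem _ c.2)).trans_lt hn

theorem isOmegaPoset_elt : IsOmegaPoset 𝒞.Elt := by
  have hfin : ∀ p : 𝒞.Elt, (Set.Ici p).Finite := fun p =>
    (finite_level_le p.level).subset fun q hq => Elt.level_le hq
  refine ⟨hfin, fun n => (finite_level_le n).subset fun p hp => ?_⟩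
  -- The filter of `p` meets every level up to that of `p`, so its size exceeds the level of `p`.
  have hsub : Set.Iic p.level ⊆ Elt.level '' Set.Ici p := fun k hk => by
    obtain ⟨q, hq, hpq⟩ := p.exists_ge hk
    exact ⟨q, hpq, hq⟩
  have hcard := (Set.ncard_le_ncard hsub ((hfin p).image _)).trans (Set.ncard_image_le (hfin p))
  rw [Set.mem_ofPred_eq] at hp ⊢
  rw [hp, Set.ncard_eq_toFinset_card', Set.toFinset_Iic, Nat.card_Iic] at hcard
  omega

theorem starBelow_of_closure_subset [CompactSpace X] {p q : 𝒞.Elt}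
    (h : closure p.set ⊆ q.set) : StarBelow p q := by
  -- The level condition upgrades inclusion in `q.set` to `e ≤ q`.
  refine ⟨{e | q.level < e.level ∧ (e.set ⊆ q.set ∨ Disjoint e.set p.set)}, ?_, ?_⟩
  · rw [isCap_iff]
    intro x
    by_cases hx : x ∈ q.set
    · obtain ⟨e, hl, hxe, he⟩ := exists_elt_subset (𝒞 := 𝒞) q.isOpen hx q.level
      exact ⟨e, ⟨hl, Or.inl he⟩, hxe⟩
    · obtain ⟨e, hl, hxe, he⟩ := exists_elt_subset (𝒞 := 𝒞) isClosed_closure.isOpen_compl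
        (fun hx' => hx (h hx')) q.level
      exact ⟨e, ⟨hl, Or.inr ((Set.subset_compl_iff_disjoint_right.1 he).mono_right
        subset_closure)⟩, hxe⟩
  · rintro e ⟨⟨hl, he | he⟩, r, hrp, hre⟩
    · exact Elt.le_of_subset hl he
    · obtain ⟨x, hx⟩ := r.nonempty
      exact absurd (Elt.set_subset hrp hx) (Set.disjoint_left.1 he (Elt.set_subset hre hx))

theorem isRegularPoset_elt [CompactSpace X] : IsRegularPoset 𝒞.Elt := by
  intro C hC
  refine ⟨{p | ∃ c ∈ C, closure p.set ⊆ c.set}, isCap_iff.2 fun x => ?_, ?_⟩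
  · obtain ⟨c, hc, hx⟩ := isCap_iff.1 hC x
    obtain ⟨K, hK, hKclosed, hKc⟩ := exists_mem_nhds_isClosed_subset (c.isOpen.mem_nhds hx)
    obtain ⟨p, -, hxp, hp⟩ := exists_elt_subset (𝒞 := 𝒞) isOpen_interior
      (mem_interior_iff_mem_nhds.2 hK) 0
    exact ⟨p, ⟨c, hc, (closure_minimal (hp.trans interior_subset) hKclosed).trans hKc⟩, hxp⟩
  · rintro p ⟨c, hc, hpc⟩
    exact ⟨c, hc, starBelow_of_closure_subset hpc⟩

theorem minimal_setOf_mem [CompactSpace X] (x : X) :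
    Minimal IsSelector {p : 𝒞.Elt | x ∈ p.set} := by
  refine ⟨fun C hC => ?_, fun T hT hTx p hp => ?_⟩
  · obtain ⟨c, hc, hx⟩ := isCap_iff.1 hC x
    exact ⟨c, hx, hc⟩
  -- Sets missing `x` cover every other point, so adding `p` gives a cap that `T` can meet only in
  -- `p`.
  · have hcap : IsCap ({q : 𝒞.Elt | x ∉ q.set} ∪ {p}) := by
      refine isCap_iff.2 fun y => ?_
      by_cases hxy : y = x
      · exact ⟨p, Or.inr rfl, hxy ▸ hp⟩
      · obtain ⟨q, -, hyq, hq⟩ := exists_elt_subset (𝒞 := 𝒞) isOpen_compl_singleton hxy 0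
        exact ⟨q, Or.inl fun hxq => hq hxq rfl, hyq⟩
    obtain ⟨q, hqT, hq | rfl⟩ := hT _ hcap
    · exact absurd (hTx hqT) hq
    · exact hqT

variable (𝒞)

/-- The minimal selector of all elements whose set contains a given point. -/
def toSpectrum [CompactSpace X] (x : X) : Spectrum 𝒞.Elt :=
  ⟨{p | x ∈ p.set}, minimal_setOf_mem x⟩

theorem continuous_toSpectrum [CompactSpace X] : Continuous 𝒞.toSpectrum := by
  refine continuous_generateFrom_iff.2 ?_
  rintro _ ⟨p, rfl⟩
  exact p.isOpen

theorem bijective_toSpectrum [CompactSpace X] : Function.Bijective 𝒞.toSpectrum := by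
  constructor
  · intro x y hxy
    by_contra hne
    obtain ⟨p, -, hxp, hp⟩ := exists_elt_subset (𝒞 := 𝒞) isOpen_compl_singleton hne 0
    have hmem : p ∈ (𝒞.toSpectrum y).1 := hxy ▸ hxp
    exact hp hmem rfl
  · intro S
    -- A minimal selector's complement is no cap, so it fails to cover some `x`; the selector of `x`
    -- then lies inside `S`.
    have hnot : ¬ IsCap S.1ᶜ := fun hC => by
      obtain ⟨p, hp, hp'⟩ := S.2.prop _ hC
      exact hp' hp
    rw [isCap_iff] at hnot
    push Not at hnot
    obtain ⟨x, hx⟩ := hnot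
    refine ⟨x, Spectrum.eq_of_subset fun p hp => ?_⟩
    by_contra hpS
    exact hx p hpS hp

/-- The regular prime `ω`-poset of a sequence of covers. -/
def toPCat [CompactSpace X] : PCat.{u} where
  carrier := 𝒞.Elt
  omega := isOmegaPoset_elt
  regular := isRegularPoset_elt
  prime p := by
    obtain ⟨x, hx⟩ := p.nonempty
    exact ⟨𝒞.toSpectrum x, hx⟩

theorem exists_homeomorph_spectrum [CompactSpace X] : Nonempty (Spectrum 𝒞.toPCat ≃ₜ X) := by
  have : T2Space (Spectrum 𝒞.Elt) := t2Space_spectrum isOmegaPoset_elt isRegularPoset_elt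
  let e : X ≃ Spectrum 𝒞.Elt := Equiv.ofBijective _ 𝒞.bijective_toSpectrum
  have he : Continuous e := 𝒞.continuous_toSpectrum
  exact ⟨he.homeoOfEquivCompactToT2.symm⟩

end CoverSeq

theorem exists_spectrum_homeomorph (X : Type u) [TopologicalSpace X] [CompactSpace X]
    [TopologicalSpace.MetrizableSpace X] : ∃ P : PCat.{u}, Nonempty (Spectrum P ≃ₜ X) := by
  let := TopologicalSpace.metrizableSpaceMetric X
  obtain ⟨𝒞⟩ := nonempty_coverSeq X
  exact ⟨𝒞.toPCat, 𝒞.exists_homeomorph_spectrum⟩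

end CoverPoset

end PosetSpectrum

/-! ### Assembly of the functor -/

theorem mainTheorem2 :
    ∃ (hobj : ∀ P : PosetSpectrum.PCat.{u},
        CompactSpace (PosetSpectrum.Spectrum P) ∧
          TopologicalSpace.MetrizableSpace (PosetSpectrum.Spectrum P))
      (hsel : ∀ (P Q : PosetSpectrum.PCat.{u}) (f : P ⟶ Q) (S : PosetSpectrum.Spectrum P),
        Minimal PosetSpectrum.IsSelector (PosetSpectrum.starImage f.rel S.1))
      (hcont : ∀ (P Q : PosetSpectrum.PCat.{u}) (f : P ⟶ Q),
        Continuous (PosetSpectrum.spectrumMap f (hsel P Q f)))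
      (hid : ∀ (P : PosetSpectrum.PCat.{u}) (S : PosetSpectrum.Spectrum P),
        PosetSpectrum.spectrumMap (𝟙 P) (hsel P P (𝟙 P)) S = S)
      (hcomp : ∀ (P Q R : PosetSpectrum.PCat.{u}) (f : P ⟶ Q) (g : Q ⟶ R)
        (S : PosetSpectrum.Spectrum P),
        PosetSpectrum.spectrumMap (f ≫ g) (hsel P R (f ≫ g)) S =
          PosetSpectrum.spectrumMap g (hsel Q R g)
            (PosetSpectrum.spectrumMap f (hsel P Q f) S)),
      (PosetSpectrum.spectrumFunctor hobj hsel hcont hid hcomp).Full ∧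
        (PosetSpectrum.spectrumFunctor hobj hsel hcont hid hcomp).EssSurj := by
  refine ⟨fun P => ⟨inferInstance, PosetSpectrum.metrizableSpace_spectrum P.omega P.regular⟩,
    PosetSpectrum.minimal_starImage, PosetSpectrum.continuous_spectrumMap,
    PosetSpectrum.spectrumMap_id, PosetSpectrum.spectrumMap_comp, ⟨fun {P Q} g => ?_⟩,
    ⟨fun X => ?_⟩⟩
  · let φ : C(PosetSpectrum.Spectrum P, PosetSpectrum.Spectrum Q) :=
      ConcreteCategory.hom (C := PosetSpectrum.KCat.{u}) g
    refine ⟨PosetSpectrum.homOfContinuous φ φ.continuous, ?_⟩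
    ext S
    exact PosetSpectrum.spectrumMap_homOfContinuous φ φ.continuous S
  · have : TopologicalSpace.MetrizableSpace X := X.prop
    obtain ⟨P, ⟨e⟩⟩ := PosetSpectrum.exists_spectrum_homeomorph X
    exact ⟨P, ⟨CompHausLike.isoOfHomeo e⟩⟩
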